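/- Let $\Sigma=\{0,1\}$, and let FP be the class of total functions computable in deterministic polynomial time, where arguments and values may be strings over $\Sigma$ or pairs of such strings (a pair is presented to a machine as the two strings with a separator between them). A total function $\rho:\Sigma^*\to\Sigma^*$ is called one-way if it is in FP; it is honest, i.e. there is a polynomial $q$ such that every $z\in\mathrm{image}(\rho)$ has some $a$ with $|a|\le q(|z|)$ and $\rho(a)=z$; and it is noninvertible, i.e. there is no $g\in\mathrm{FP}$ with $\rho(g(z))=z$ for all $z\in\mathrm{image}(\rho)$. A total function $\sigma:\Sigma^*\times\Sigma^*\to\Sigma^*$ is called one-way if it is in FP; it is honest, i.e. there is a polynomial $q$ such that every $z\in\mathrm{image}(\sigma)$ has some $(a,b)$ with $|a|+|b|\le q(|z|)$ and $\sigma(a,b)=z$; and there is no $g\in\mathrm{FP}$, $g:\Sigma^*\to\Sigma^*\times\Sigma^*$, with $\sigma(g(z))=z$ for all $z\in\mathrm{image}(\sigma)$. **Theorem.** If $\mathrm{P}\neq\mathrm{NP}$, then there is a total 2-ary function $\sigma:\Sigma^*\times\Sigma^*\to\Sigma^*$ such that: 1. $\sigma$ is one-way; 2. $\sigma$ is s-honest: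 there is a polynomial $q$ such that for all $z,a$ for which some $b$ satisfies $\sigma(a,b)=z$ there is $b'$ with $|b'|\le q(|z|+|a|)$ and $\sigma(a,b')=z$, and for all $z,b$ for which some $a$ satisfies $\sigma(a,b)=z$ there is $a'$ with $|a'|\le q(|z|+|b|)$ and $\sigma(a',b)=z$; 3. $\sigma$ is invertible with respect to its first argument: there is $g_1\in\mathrm{FP}$ such that $\sigma(a,g_1(a,z))=z$ whenever $\sigma(a,b)=z$ for some $b$; 4. $\sigma$ is invertible with respect to its second argument: there is $g_2\in\mathrm{FP}$ such that $\sigma(g_2(b,z),b)=z$ whenever $\sigma(a,b)=z$ for some $a$. Moreover, $\sigma$ can be taken of the form $\sigma(a,b)=1\rho(a)$ if $a=b$ and $\sigma(a,b)=0ab$ if $a\neq b$, for some total one-way function $\rho:\Sigma^*\to\Sigma^*$. -/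

import Mathlib

namespace OneWay

/-- Strings over the binary alphabet (`false` is the letter 0, `true` is the letter 1). -/
abbrev Word : Type := List Bool

/-- A pair of words written on a tape: the two words, separated by the extra letter `none`. -/
def encodePair (p : Word × Word) : List (Option Bool) :=
  p.1.map some ++ none :: p.2.map some

/-- The word `a` as the content of a tape over the binary alphabet. -/
def encodeWord (a : Word) : List Bool := a

/-- A truth value as the content of a tape: the one-letter word. -/
def encodeBit (b : Bool) : List Bool := [b]

/-- `f` is computed by a deterministic multi-stack Turing machine (finitely many stacks, labels and
internal states; every statement pushes one of finitely many letters, so that only finitely many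
letters ever occur on its stacks) within a number of steps that is bounded by a polynomial in the
length of the input. Inputs and outputs are presented through `ea` and `eb`. -/
def PolyTime {α β αΓ βΓ : Type} (ea : α → List αΓ) (eb : β → List βΓ) (f : α → β) : Prop :=
  Nonempty (Turing.TM2ComputableInPolyTime ea eb f)

/-- The class P: languages with a polynomial-time decision procedure. -/
def classP : Set (Language Bool) :=
  {L | ∃ d : Word → Bool, PolyTime encodeWord encodeBit d ∧ ∀ x : Word, x ∈ L ↔ d x = true}

/-- The class NP: languages with a polynomial-time verifier and certificates of polynomially
bounded length. -/
def classNP : Set (Language Bool) :=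
  {L | ∃ (v : Word × Word → Bool) (p : Polynomial ℕ), PolyTime encodePair encodeBit v ∧
    ∀ x : Word, x ∈ L ↔ ∃ w : Word, w.length ≤ p.eval x.length ∧ v (x, w) = true}

/-! ### Total 1-ary functions -/

/-- Every image element has a preimage of polynomially bounded length. -/
def Honest₁ (ρ : Word → Word) : Prop :=
  ∃ q : Polynomial ℕ, ∀ z ∈ Set.range ρ, ∃ a : Word, a.length ≤ q.eval z.length ∧ ρ a = z

/-- Some total polynomial-time computable function finds preimages. -/
def Invertible₁ (ρ : Word → Word) : Prop :=
  ∃ g : Word → Word, PolyTime encodeWord encodeWord g ∧ ∀ z ∈ Set.range ρ, ρ (g z) = z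

/-- Total 1-ary one-way functions. -/
def IsOneWay₁ (ρ : Word → Word) : Prop :=
  Honest₁ ρ ∧ PolyTime encodeWord encodeWord ρ ∧ ¬ Invertible₁ ρ

/-! ### Total 2-ary functions -/

/-- Every image element has a preimage `(a, b)` of polynomially bounded total length. -/
def Honest₂ (σ : Word × Word → Word) : Prop :=
  ∃ q : Polynomial ℕ, ∀ z ∈ Set.range σ, ∃ a b : Word,
    a.length + b.length ≤ q.eval z.length ∧ σ (a, b) = z

/-- Some total polynomial-time computable function finds preimages. -/
def Invertible₂ (σ : Word × Word → Word) : Prop :=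
  ∃ g : Word → Word × Word, PolyTime encodeWord encodePair g ∧ ∀ z ∈ Set.range σ, σ (g z) = z

/-- Total 2-ary one-way functions. -/
def IsOneWay₂ (σ : Word × Word → Word) : Prop :=
  Honest₂ σ ∧ PolyTime encodePair encodeWord σ ∧ ¬ Invertible₂ σ

/-- s-honesty: whenever `z` is attained with one argument prescribed, it is attained with that
argument and another argument of length polynomial in the lengths of `z` and the prescribed one. -/
def SHonest (σ : Word × Word → Word) : Prop :=
  ∃ q : Polynomial ℕ,
    (∀ z a : Word, (∃ b : Word, σ (a, b) = z) →
      ∃ b' : Word, b'.length ≤ q.eval (z.length + a.length) ∧ σ (a, b') = z) ∧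
    (∀ z b : Word, (∃ a : Word, σ (a, b) = z) →
      ∃ a' : Word, a'.length ≤ q.eval (z.length + b.length) ∧ σ (a', b) = z)

/-- Given the first argument and the value, a matching second argument is found in polynomial
time. -/
def InvertibleFst (σ : Word × Word → Word) : Prop :=
  ∃ g₁ : Word × Word → Word, PolyTime encodePair encodeWord g₁ ∧
    ∀ z ∈ Set.range σ, ∀ a b : Word, σ (a, b) = z → σ (a, g₁ (a, z)) = z

/-- Given the second argument and the value, a matching first argument is found in polynomial
time. -/
def InvertibleSnd (σ : Word × Word → Word) : Prop :=
  ∃ g₂ : Word × Word → Word, PolyTime encodePair encodeWord g₂ ∧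
    ∀ z ∈ Set.range σ, ∀ a b : Word, σ (a, b) = z → σ (g₂ (b, z), b) = z

end OneWay

/-! A language in NP but not in P yields a one-way `ρ`, and placing `ρ` on the diagonal yields `σ`.

Let `L` have verifier `v` and certificate bound `p`. A word `a` is read as an instance `x` with a
padded certificate `w` (`parse`). If `v` accepts, `forget v` overwrites padding and certificate by
ones and puts the tag 1 in front; otherwise it returns `a` with tag 0. Lengths grow by exactly one,
so `forget v` is honest. The padding gives all certificates of length at most `p(|x|)` one common
image, `true :: query x (p(|x|))`; hence `x ∈ L` iff that word lies in the range (`mem_iff_forget`).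
An inverter `g` would decide `L`: apply `g` to this word and test whether `forget v` maps the result
back to it (`exists_isOneWay₁`).

For `diagonal ρ`, the first letter of a value tells whether the arguments are equal. With one
argument known, the other is either the same word or what remains of a concatenation after removing
the known part, so both one-sided inversions are easy. With neither known, a preimage of `true :: z`
must be a pair `(a, a)` with `ρ a = z`, so an inverter would invert `ρ` (`isOneWay₂_diagonal`).

Most of the work is to show that these functions are polynomial-time on multi-stack machines. Three
machines are programmed directly: finite transducers, parallel reading of two lists, and unary
multiplication. They are combined by `PolyTime.memo`, which runs one machine after another while
keeping the original input available; composition, concatenation, case distinction, equality tests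
and unary polynomial values follow without further programming. -/

namespace OneWay

open Turing StateTransition Function

/-! ### Runs of a transition function -/

/-- `Steps f n a b`: the transition function `f` leads from `a` to `b` in exactly `n` steps. -/
inductive Steps {S : Type*} (f : S → Option S) : ℕ → S → S → Prop
  | refl (a : S) : Steps f 0 a a
  | head {n : ℕ} {a b c : S} : f a = some b → Steps f n b c → Steps f (n + 1) a c

theorem Steps.trans {S : Type*} {f : S → Option S} {m n : ℕ} {a b c : S}
    (h : Steps f m a b) (h' : Steps f n b c) : Steps f (m + n) a c := by
  induction h with
  | refl => simpa using h'
  | head e _ ih => rw [Nat.add_right_comm]; exact .head e (ih h')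

theorem iterate_bind_none {S : Type*} (f : S → Option S) (n : ℕ) :
    (flip bind f)^[n] none = none := by
  induction n with
  | zero => rfl
  | succ n ih => rw [iterate_succ_apply]; exact ih

/-- Connects the inductive form, in which runs concatenate and step counts add, with the iteration
in Mathlib's definition of computation. -/
theorem steps_iff {S : Type*} {f : S → Option S} {n : ℕ} {a b : S} :
    Steps f n a b ↔ (flip bind f)^[n] (some a) = some b := by
  constructor
  · intro h
    induction h with
    | refl => rfl
    | head e _ ih => rw [iterate_succ_apply, ← ih, ← e]; rfl
  · induction n generalizing a with
    | zero => intro h; obtain rfl : a = b := by simpa using h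
              exact .refl _
    | succ n ih =>
      rw [iterate_succ_apply, show flip bind f (some a) = f a from rfl]
      intro h
      cases e : f a with
      | none => rw [e, iterate_bind_none] at h; cases h
      | some c => exact .head e (ih (e ▸ h))

theorem initList_eq (M : FinTM2) (s : List (M.Γ M.k₀)) :
    initList M s = ⟨some M.main, M.initialState, update (fun _ => []) M.k₀ s⟩ := by
  unfold initList
  congr 1
  funext k
  by_cases h : k = M.k₀
  · subst h; simp
  · simp [h]

theorem haltList_eq (M : FinTM2) (s : List (M.Γ M.k₁)) :
    haltList M s = ⟨none, M.initialState, update (fun _ => []) M.k₁ s⟩ := by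
  unfold haltList
  congr 1
  funext k
  by_cases h : k = M.k₁
  · subst h; simp
  · simp [h]

/-- The final configuration must have the initial internal state and no letters outside the output
stack. This is why the programs below reset their buffers and empty their auxiliary stacks. -/
theorem PolyTime.intro {α β αΓ βΓ : Type} {ea : α → List αΓ} {eb : β → List βΓ} {f : α → β}
    (M : FinTM2) (i : M.Γ M.k₀ ≃ αΓ) (o : M.Γ M.k₁ ≃ βΓ) (p : Polynomial ℕ)
    (h : ∀ a, ∃ n ≤ p.eval (ea a).length, Steps (TM2.step M.m) n
      ⟨some M.main, M.initialState, update (fun _ => []) M.k₀ ((ea a).map i.symm)⟩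
      ⟨none, M.initialState, update (fun _ => []) M.k₁ ((eb (f a)).map o.symm)⟩) :
    PolyTime ea eb f := by
  choose n hn hs using h
  refine ⟨⟨⟨M, i, o⟩, p, fun a => ⟨⟨n a, ?_⟩, hn a⟩⟩⟩
  have := steps_iff.1 (hs a)
  simp only [Option.map_some]
  rw [initList_eq, haltList_eq]
  exact this

theorem PolyTime.elim {α β αΓ βΓ : Type} {ea : α → List αΓ} {eb : β → List βΓ} {f : α → β}
    (h : PolyTime ea eb f) : ∃ (M : FinTM2) (i : M.Γ M.k₀ ≃ αΓ) (o : M.Γ M.k₁ ≃ βΓ)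
      (p : Polynomial ℕ), ∀ a, ∃ n ≤ p.eval (ea a).length, Steps (TM2.step M.m) n
      ⟨some M.main, M.initialState, update (fun _ => []) M.k₀ ((ea a).map i.symm)⟩
      ⟨none, M.initialState, update (fun _ => []) M.k₁ ((eb (f a)).map o.symm)⟩ := by
  obtain ⟨⟨⟨M, i, o⟩, p, h⟩⟩ := h
  refine ⟨M, i, o, p, fun a => ?_⟩
  obtain ⟨⟨n, hs⟩, hn⟩ := h a
  refine ⟨n, hn, steps_iff.2 ?_⟩
  simp only [Option.map_some] at hs
  rw [initList_eq, haltList_eq] at hs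
  exact hs

/-- Coefficients in `ℕ` are nonnegative. -/
theorem eval_mono (p : Polynomial ℕ) {m n : ℕ} (h : m ≤ n) : p.eval m ≤ p.eval n := by
  rw [Polynomial.eval_eq_sum, Polynomial.eval_eq_sum]
  exact Finset.sum_le_sum fun i _ => Nat.mul_le_mul_left _ (Nat.pow_le_pow_left h i)

section Stmt

variable {K : Type} [DecidableEq K] {Γ : K → Type} {Λ σ : Type}

/-! ### Growth of the stacks -/

/-- The number of push instructions in a statement. -/
def pushes : TM2.Stmt Γ Λ σ → ℕ
  | .push _ _ q => pushes q + 1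
  | .peek _ _ q => pushes q
  | .pop _ _ q => pushes q
  | .load _ q => pushes q
  | .branch _ q₁ q₂ => pushes q₁ + pushes q₂
  | .goto _ => 0
  | .halt => 0

theorem length_stepAux_le (q : TM2.Stmt Γ Λ σ) (v : σ) (S : ∀ k, List (Γ k)) (k : K) :
    ((TM2.stepAux q v S).stk k).length ≤ (S k).length + pushes q := by
  induction q generalizing v S with
  | push k' f q ih =>
    refine (ih _ _).trans ?_
    by_cases h : k = k'
    · subst h; simp [pushes, add_assoc, add_comm]
    · simp [h, pushes]
  | peek k' f q ih => exact ih _ _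
  | pop k' f q ih =>
    refine (ih _ _).trans ?_
    by_cases h : k = k'
    · subst h; simp [pushes]
    · simp [h, pushes]
  | load f q ih => exact ih _ _
  | branch f q₁ q₂ ih₁ ih₂ =>
    rw [TM2.stepAux]
    cases f v
    · exact (ih₂ _ _).trans (by simp [pushes])
    · exact (ih₁ _ _).trans (by simp [pushes])
  | goto f => simp [pushes]
  | halt => simp [pushes]

/-- Time bounds output length: one step executes one statement, which pushes at most `N` letters.
Composing two machines needs this to bound the input of the second. -/
theorem Steps.length_le {m : Λ → TM2.Stmt Γ Λ σ} {N n : ℕ} (hN : ∀ l, pushes (m l) ≤ N)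
    {c c' : TM2.Cfg Γ Λ σ} (h : Steps (TM2.step m) n c c') (k : K) :
    (c'.stk k).length ≤ (c.stk k).length + n * N := by
  induction h with
  | refl => simp
  | @head n a b c e _ ih =>
    obtain ⟨_ | l, v, S⟩ := a
    · cases e
    · simp only [TM2.step, Option.some.injEq] at e
      subst e
      have h1 := length_stepAux_le (m l) v S k
      have h2 := hN l
      rw [add_mul]
      simp only at ih ⊢
      omega

/-! ### Pushing several letters -/

open Classical in
/-- Push a list of at most `n` letters that is computed from the internal state. -/
noncomputable def pushList (k : K) : ℕ → (σ → List (Γ k)) → TM2.Stmt Γ Λ σ → TM2.Stmt Γ Λ σ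
  | 0, _, q => q
  | n + 1, f, q =>
    -- A push needs a letter for every internal state, and the alphabet may be empty. The default
    -- letter is never pushed, because emptiness of the list is tested first.
    if h : Nonempty (Γ k) then
      .branch (fun s => (f s).isEmpty) q
        (.push k (fun s => (f s).headD h.some) (pushList k n (fun s => (f s).tail) q))
    else q

theorem stepAux_pushList (k : K) (n : ℕ) (f : σ → List (Γ k)) (q : TM2.Stmt Γ Λ σ) (v : σ)
    (S : ∀ k, List (Γ k)) (h : (f v).length ≤ n) :
    TM2.stepAux (pushList k n f q) v S =
      TM2.stepAux q v (update S k ((f v).reverse ++ S k)) := by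
  induction n generalizing f S with
  | zero =>
    have : f v = [] := by simpa using h
    simp [pushList, this]
  | succ n ih =>
    rw [pushList]
    split_ifs with hk
    · simp only [TM2.stepAux]
      cases e : f v with
      | nil => simp
      | cons a t =>
        rw [ih _ _ (by rw [e] at h ⊢; simpa using h)]
        simp [e]
    · cases e : f v with
      | nil => simp
      | cons a t => exact absurd ⟨a⟩ hk

theorem stepAux_pushList_toList (k : K) (f : σ → Option (Γ k)) (q : TM2.Stmt Γ Λ σ) (v : σ)
    (S : ∀ k, List (Γ k)) :
    TM2.stepAux (pushList k 1 (fun s => (f s).toList) q) v S =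
      TM2.stepAux q v (update S k ((f v).toList ++ S k)) := by
  rw [stepAux_pushList _ _ _ _ _ _ (by cases f v <;> simp)]
  cases f v <;> simp

/-! ### Machines inside larger machines -/

variable {K' : Type} [DecidableEq K'] {Γ' : K' → Type} {Λ' σ' : Type}

/-- Translation of a statement to a machine with more stacks and a larger internal state; halting
is replaced by the statement `e`. -/
def translate (iK : K → K') (get : σ' → σ) (put : σ → σ' → σ') (iΛ : Λ → Λ')
    (e : TM2.Stmt Γ' Λ' σ') : TM2.Stmt (fun k => Γ' (iK k)) Λ σ → TM2.Stmt Γ' Λ' σ'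
  | .push k f q => .push (iK k) (fun s => f (get s)) (translate iK get put iΛ e q)
  | .peek k f q =>
    .peek (iK k) (fun s x => put (f (get s) x) s) (translate iK get put iΛ e q)
  | .pop k f q =>
    .pop (iK k) (fun s x => put (f (get s) x) s) (translate iK get put iΛ e q)
  | .load f q => .load (fun s => put (f (get s)) s) (translate iK get put iΛ e q)
  | .branch f q₁ q₂ => .branch (fun s => f (get s)) (translate iK get put iΛ e q₁)
      (translate iK get put iΛ e q₂)
  | .goto f => .goto (fun s => iΛ (f (get s)))
  | .halt => e

/-- `V` and `G` embed internal states and stacks with the rest of the large machine held fixed.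
Since the small program touches only its own part, each step commutes with the embedding; a halted
configuration corresponds to the label `exit`. -/
theorem stepAux_translate {iK : K → K'} {get : σ' → σ} {put : σ → σ' → σ'} {iΛ : Λ → Λ'}
    {e : TM2.Stmt Γ' Λ' σ'} {exit : Option Λ'} {V : σ → σ'}
    {G : (∀ k, List (Γ' (iK k))) → ∀ k, List (Γ' k)}
    (he : ∀ v S, TM2.stepAux e v S = ⟨exit, v, S⟩)
    (hget : ∀ s, get (V s) = s) (hput : ∀ s t, put t (V s) = V t)
    (hG : ∀ S k, G S (iK k) = S k) (hup : ∀ S k x, update (G S) (iK k) x = G (update S k x))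
    (q : TM2.Stmt (fun k => Γ' (iK k)) Λ σ) (v : σ) (S : ∀ k, List (Γ' (iK k))) :
    TM2.stepAux (translate iK get put iΛ e q) (V v) (G S) =
      ⟨((TM2.stepAux q v S).l.map iΛ).or exit, V (TM2.stepAux q v S).var,
        G (TM2.stepAux q v S).stk⟩ := by
  induction q generalizing v S with
  | push k f q ih => simp [translate, hget, hG, hup, ih]
  | peek k f q ih => simp [translate, hget, hput, hG, ih]
  | pop k f q ih => simp [translate, hget, hput, hG, hup, ih]
  | load f q ih => simp [translate, hget, hput, ih]
  | branch f q₁ q₂ ih₁ ih₂ =>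
    simp only [translate, TM2.stepAux, hget]
    cases f v
    · exact ih₂ _ _
    · exact ih₁ _ _
  | goto f => simp [translate, hget]
  | halt => simp [translate, he]

theorem Steps.translate {iK : K → K'} {get : σ' → σ} {put : σ → σ' → σ'} {iΛ : Λ → Λ'}
    {e : TM2.Stmt Γ' Λ' σ'} {exit : Option Λ'} {V : σ → σ'}
    {G : (∀ k, List (Γ' (iK k))) → ∀ k, List (Γ' k)}
    (he : ∀ v S, TM2.stepAux e v S = ⟨exit, v, S⟩)
    (hget : ∀ s, get (V s) = s) (hput : ∀ s t, put t (V s) = V t)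
    (hG : ∀ S k, G S (iK k) = S k) (hup : ∀ S k x, update (G S) (iK k) x = G (update S k x))
    {m : Λ → TM2.Stmt (fun k => Γ' (iK k)) Λ σ} {m' : Λ' → TM2.Stmt Γ' Λ' σ'}
    (hm : ∀ l, m' (iΛ l) = OneWay.translate iK get put iΛ e (m l))
    {n : ℕ} {c c' : TM2.Cfg (fun k => Γ' (iK k)) Λ σ} (h : Steps (TM2.step m) n c c') :
    Steps (TM2.step m') n ⟨(c.l.map iΛ).or exit, V c.var, G c.stk⟩
      ⟨(c'.l.map iΛ).or exit, V c'.var, G c'.stk⟩ := by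
  induction h with
  | refl => exact .refl _
  | @head n a b c e' _ ih =>
    obtain ⟨_ | l, v, S⟩ := a
    · cases e'
    · simp only [TM2.step, Option.some.injEq] at e'
      subst e'
      refine .head ?_ ih
      simp only [Option.map_some, Option.some_or, TM2.step, hm]
      rw [stepAux_translate he hget hput hG hup]

end Stmt

/-! ### Running one machine after another, with access to the original input -/

/-- The phases in which the connecting machine moves letters between stacks. -/
inductive Phase
  | unload | reload | collect | feed
  deriving DecidableEq

instance : Fintype Phase :=
  ⟨{.unload, .reload, .collect, .feed}, fun x => by cases x <;> simp⟩

section Memo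

variable (M₁ M₂ : FinTM2)

/-- The alphabets of the stacks: those of the two machines and of two auxiliary stacks. -/
abbrev MemoΓ : M₁.K ⊕ M₂.K ⊕ Bool → Type
  | .inl k => M₁.Γ k
  | .inr (.inl k) => M₂.Γ k
  | .inr (.inr false) => M₁.Γ M₁.k₀
  | .inr (.inr true) => M₁.Γ M₁.k₁

/-- The internal states: those of the two machines and buffers for two letters. -/
abbrev MemoState : Type := M₁.σ × M₂.σ × Option (M₁.Γ M₁.k₀) × Option (M₁.Γ M₁.k₁)

/-- The labels. -/
abbrev MemoLabel : Type := M₁.Λ ⊕ M₂.Λ ⊕ Phase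

variable {M₁ M₂}

/-- All stacks together. -/
def memoStk (S₁ : ∀ k, List (M₁.Γ k)) (S₂ : ∀ k, List (M₂.Γ k)) (A : List (M₁.Γ M₁.k₀))
    (B : List (M₁.Γ M₁.k₁)) : ∀ k, List (MemoΓ M₁ M₂ k)
  | .inl k => S₁ k
  | .inr (.inl k) => S₂ k
  | .inr (.inr false) => A
  | .inr (.inr true) => B

theorem update_memoStk_fst (S₁ : ∀ k, List (M₁.Γ k)) (S₂ : ∀ k, List (M₂.Γ k))
    (A : List (M₁.Γ M₁.k₀)) (B : List (M₁.Γ M₁.k₁)) (k : M₁.K) (x : List (M₁.Γ k)) :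
    update (memoStk S₁ S₂ A B) (.inl k) x = memoStk (update S₁ k x) S₂ A B := by
  funext j
  rcases j with j | j | _ | _ <;> try rfl
  by_cases h : j = k
  · subst h; simp [memoStk]
  · simp [memoStk, h]

theorem update_memoStk_snd (S₁ : ∀ k, List (M₁.Γ k)) (S₂ : ∀ k, List (M₂.Γ k))
    (A : List (M₁.Γ M₁.k₀)) (B : List (M₁.Γ M₁.k₁)) (k : M₂.K) (x : List (M₂.Γ k)) :
    update (memoStk S₁ S₂ A B) (.inr (.inl k)) x = memoStk S₁ (update S₂ k x) A B := by
  funext j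
  rcases j with j | j | _ | _ <;> try rfl
  by_cases h : j = k
  · subst h; simp [memoStk]
  · simp [memoStk, h]

theorem update_memoStk_false (S₁ : ∀ k, List (M₁.Γ k)) (S₂ : ∀ k, List (M₂.Γ k))
    (A x : List (M₁.Γ M₁.k₀)) (B : List (M₁.Γ M₁.k₁)) :
    update (memoStk S₁ S₂ A B) (.inr (.inr false)) x = memoStk S₁ S₂ x B := by
  funext j
  rcases j with j | j | _ | _ <;> simp [memoStk]

theorem update_memoStk_true (S₁ : ∀ k, List (M₁.Γ k)) (S₂ : ∀ k, List (M₂.Γ k))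
    (A : List (M₁.Γ M₁.k₀)) (B x : List (M₁.Γ M₁.k₁)) :
    update (memoStk S₁ S₂ A B) (.inr (.inr true)) x = memoStk S₁ S₂ A x := by
  funext j
  rcases j with j | j | _ | _ <;> simp [memoStk]

variable (φ : M₁.Γ M₁.k₁ → Option (M₂.Γ M₂.k₀)) (ψ : M₁.Γ M₁.k₀ → Option (M₂.Γ M₂.k₀))

/-- The program: copy the input to an auxiliary stack and back, on the way back also through `ψ`
onto the input stack of the second machine; run the first machine; move its output through `φ` to
the input of the second machine; run the second machine. -/
noncomputable def memoProgram :
    MemoLabel M₁ M₂ → TM2.Stmt (MemoΓ M₁ M₂) (MemoLabel M₁ M₂) (MemoState M₁ M₂)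
  | .inl l => translate (Γ' := MemoΓ M₁ M₂) Sum.inl (fun s => s.1) (fun t s => (t, s.2)) Sum.inl
      (.goto fun _ => .inr (.inr .collect)) (M₁.m l)
  | .inr (.inl l) => translate (Γ' := MemoΓ M₁ M₂) (fun k => Sum.inr (Sum.inl k)) (fun s => s.2.1)
      (fun t s => (s.1, t, s.2.2)) (fun l => Sum.inr (Sum.inl l)) .halt (M₂.m l)
  | .inr (.inr .unload) =>
    .pop (.inl M₁.k₀) (fun s x => (s.1, s.2.1, x, none)) <|
    .branch (fun s => s.2.2.1.isSome)
      (pushList (.inr (.inr false)) 1 (fun s => s.2.2.1.toList) <|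
        .load (fun s => (s.1, s.2.1, none, none)) <| .goto fun _ => .inr (.inr .unload))
      (.goto fun _ => .inr (.inr .reload))
  | .inr (.inr .reload) =>
    .pop (.inr (.inr false)) (fun s x => (s.1, s.2.1, x, none)) <|
    .branch (fun s => s.2.2.1.isSome)
      (pushList (.inl M₁.k₀) 1 (fun s => s.2.2.1.toList) <|
        pushList (.inr (.inl M₂.k₀)) 1 (fun s => (s.2.2.1.bind ψ).toList) <|
        .load (fun s => (s.1, s.2.1, none, none)) <| .goto fun _ => .inr (.inr .reload))
      (.goto fun _ => .inl M₁.main)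
  | .inr (.inr .collect) =>
    .pop (.inl M₁.k₁) (fun s x => (s.1, s.2.1, none, x)) <|
    .branch (fun s => s.2.2.2.isSome)
      (pushList (.inr (.inr true)) 1 (fun s => s.2.2.2.toList) <|
        .load (fun s => (s.1, s.2.1, none, none)) <| .goto fun _ => .inr (.inr .collect))
      (.goto fun _ => .inr (.inr .feed))
  | .inr (.inr .feed) =>
    .pop (.inr (.inr true)) (fun s x => (s.1, s.2.1, none, x)) <|
    .branch (fun s => s.2.2.2.isSome)
      (pushList (.inr (.inl M₂.k₀)) 1 (fun s => (s.2.2.2.bind φ).toList) <|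
        .load (fun s => (s.1, s.2.1, none, none)) <| .goto fun _ => .inr (.inr .feed))
      (.goto fun _ => .inr (.inl M₂.main))

theorem steps_unload (l A : List (M₁.Γ M₁.k₀)) (S₂ : ∀ k, List (M₂.Γ k)) (B : List (M₁.Γ M₁.k₁))
    (v₁ : M₁.σ) (v₂ : M₂.σ) (S₁ : ∀ k, List (M₁.Γ k)) :
    Steps (TM2.step (memoProgram φ ψ)) (l.length + 1)
      ⟨some (.inr (.inr .unload)), (v₁, v₂, none, none), memoStk (update S₁ M₁.k₀ l) S₂ A B⟩
      ⟨some (.inr (.inr .reload)), (v₁, v₂, none, none),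
        memoStk (update S₁ M₁.k₀ []) S₂ (l.reverse ++ A) B⟩ := by
  induction l generalizing A with
  | nil =>
    refine .head ?_ (.refl _)
    simp [TM2.step, memoProgram, memoStk, update_memoStk_fst]
  | cons a l ih =>
    refine .head ?_ (by simpa using ih (a :: A))
    simp [TM2.step, memoProgram, memoStk, update_memoStk_fst, stepAux_pushList_toList,
      update_memoStk_false]

theorem steps_reload (l : List (M₁.Γ M₁.k₀)) (X : List (M₁.Γ M₁.k₀)) (Y : List (M₂.Γ M₂.k₀))
    (S₂ : ∀ k, List (M₂.Γ k)) (B : List (M₁.Γ M₁.k₁))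
    (v₁ : M₁.σ) (v₂ : M₂.σ) (S₁ : ∀ k, List (M₁.Γ k)) :
    Steps (TM2.step (memoProgram φ ψ)) (l.length + 1)
      ⟨some (.inr (.inr .reload)), (v₁, v₂, none, none),
        memoStk (update S₁ M₁.k₀ X) (update S₂ M₂.k₀ Y) l B⟩
      ⟨some (.inl M₁.main), (v₁, v₂, none, none),
        memoStk (update S₁ M₁.k₀ (l.reverse ++ X))
          (update S₂ M₂.k₀ (l.reverse.filterMap ψ ++ Y)) [] B⟩ := by
  induction l generalizing X Y with
  | nil =>
    refine .head ?_ (.refl _)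
    simp [TM2.step, memoProgram, memoStk, update_memoStk_false]
  | cons a l ih =>
    have e : (a :: l).reverse.filterMap ψ ++ Y = l.reverse.filterMap ψ ++ ((ψ a).toList ++ Y) := by
      cases h : ψ a <;> simp [h]
    rw [e, List.reverse_cons, List.append_assoc]
    refine .head ?_ (ih (a :: X) ((ψ a).toList ++ Y))
    simp [TM2.step, memoProgram, memoStk, update_memoStk_fst, stepAux_pushList_toList,
      update_memoStk_false, update_memoStk_snd]

theorem steps_collect (l B : List (M₁.Γ M₁.k₁)) (S₂ : ∀ k, List (M₂.Γ k)) (A : List (M₁.Γ M₁.k₀))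
    (v₁ : M₁.σ) (v₂ : M₂.σ) (S₁ : ∀ k, List (M₁.Γ k)) :
    Steps (TM2.step (memoProgram φ ψ)) (l.length + 1)
      ⟨some (.inr (.inr .collect)), (v₁, v₂, none, none), memoStk (update S₁ M₁.k₁ l) S₂ A B⟩
      ⟨some (.inr (.inr .feed)), (v₁, v₂, none, none),
        memoStk (update S₁ M₁.k₁ []) S₂ A (l.reverse ++ B)⟩ := by
  induction l generalizing B with
  | nil =>
    refine .head ?_ (.refl _)
    simp [TM2.step, memoProgram, memoStk, update_memoStk_fst]
  | cons a l ih =>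
    refine .head ?_ (by simpa using ih (a :: B))
    simp [TM2.step, memoProgram, memoStk, update_memoStk_fst, stepAux_pushList_toList,
      update_memoStk_true]

theorem steps_feed (l : List (M₁.Γ M₁.k₁)) (Y : List (M₂.Γ M₂.k₀))
    (S₂ : ∀ k, List (M₂.Γ k)) (A : List (M₁.Γ M₁.k₀))
    (v₁ : M₁.σ) (v₂ : M₂.σ) (S₁ : ∀ k, List (M₁.Γ k)) :
    Steps (TM2.step (memoProgram φ ψ)) (l.length + 1)
      ⟨some (.inr (.inr .feed)), (v₁, v₂, none, none),
        memoStk S₁ (update S₂ M₂.k₀ Y) A l⟩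
      ⟨some (.inr (.inl M₂.main)), (v₁, v₂, none, none),
        memoStk S₁ (update S₂ M₂.k₀ (l.reverse.filterMap φ ++ Y)) A []⟩ := by
  induction l generalizing Y with
  | nil =>
    refine .head ?_ (.refl _)
    simp [TM2.step, memoProgram, memoStk, update_memoStk_true]
  | cons a l ih =>
    have e : (a :: l).reverse.filterMap φ ++ Y = l.reverse.filterMap φ ++ ((φ a).toList ++ Y) := by
      cases h : φ a <;> simp [h]
    rw [e]
    refine .head ?_ (ih ((φ a).toList ++ Y))
    simp [TM2.step, memoProgram, memoStk, stepAux_pushList_toList,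
      update_memoStk_true, update_memoStk_snd]

theorem steps_fst {n : ℕ} {v v' : M₁.σ} {S S' : ∀ k, List (M₁.Γ k)} {l : M₁.Λ}
    (h : Steps (TM2.step M₁.m) n ⟨some l, v, S⟩ ⟨none, v', S'⟩) (v₂ : M₂.σ)
    (S₂ : ∀ k, List (M₂.Γ k)) (A : List (M₁.Γ M₁.k₀)) (B : List (M₁.Γ M₁.k₁)) :
    Steps (TM2.step (memoProgram φ ψ)) n
      ⟨some (.inl l), (v, v₂, none, none), memoStk S S₂ A B⟩
      ⟨some (.inr (.inr .collect)), (v', v₂, none, none), memoStk S' S₂ A B⟩ :=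
  Steps.translate (Γ' := MemoΓ M₁ M₂) (iK := Sum.inl) (get := fun s : MemoState M₁ M₂ => s.1)
    (put := fun t s => (t, s.2)) (iΛ := Sum.inl)
    (e := .goto fun _ => .inr (.inr .collect)) (exit := some (Sum.inr (Sum.inr Phase.collect)))
    (V := fun v => (v, v₂, none, none)) (G := fun S => memoStk S S₂ A B)
    (fun _ _ => rfl) (fun _ => rfl) (fun _ _ => rfl) (fun _ _ => rfl)
    (fun _ _ _ => update_memoStk_fst _ _ _ _ _ _) (m := M₁.m) (fun _ => rfl) h

theorem steps_snd {n : ℕ} {v v' : M₂.σ} {S S' : ∀ k, List (M₂.Γ k)} {l : M₂.Λ}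
    (h : Steps (TM2.step M₂.m) n ⟨some l, v, S⟩ ⟨none, v', S'⟩) (v₁ : M₁.σ)
    (S₁ : ∀ k, List (M₁.Γ k)) (A : List (M₁.Γ M₁.k₀)) (B : List (M₁.Γ M₁.k₁)) :
    Steps (TM2.step (memoProgram φ ψ)) n
      ⟨some (.inr (.inl l)), (v₁, v, none, none), memoStk S₁ S A B⟩
      ⟨none, (v₁, v', none, none), memoStk S₁ S' A B⟩ :=
  Steps.translate (Γ' := MemoΓ M₁ M₂) (iK := fun k => Sum.inr (Sum.inl k))
    (get := fun s : MemoState M₁ M₂ => s.2.1)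
    (put := fun t s => (s.1, t, s.2.2)) (iΛ := fun l => Sum.inr (Sum.inl l))
    (e := .halt) (exit := none)
    (V := fun v => (v₁, v, none, none)) (G := fun S => memoStk S₁ S A B)
    (fun _ _ => rfl) (fun _ => rfl) (fun _ _ => rfl) (fun _ _ => rfl)
    (fun _ _ _ => update_memoStk_snd _ _ _ _ _ _) (m := M₂.m) (fun _ => rfl) h

/-- The combined machine. -/
noncomputable def memoMachine [Fintype (M₁.Γ M₁.k₁)] : FinTM2 :=
  letI := M₁.kFin
  letI := M₂.kFin
  letI := M₁.ΛFin
  letI := M₂.ΛFin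
  letI := M₁.σFin
  letI := M₂.σFin
  letI := M₁.Γk₀Fin
  { K := M₁.K ⊕ M₂.K ⊕ Bool
    k₀ := .inl M₁.k₀
    k₁ := .inr (.inl M₂.k₁)
    Γ := MemoΓ M₁ M₂
    Λ := MemoLabel M₁ M₂
    main := .inr (.inr .unload)
    σ := MemoState M₁ M₂
    initialState := (M₁.initialState, M₂.initialState, none, none)
    Γk₀Fin := M₁.Γk₀Fin
    m := memoProgram φ ψ }

theorem memoStk_nil (M₁ M₂ : FinTM2) :
    memoStk (M₁ := M₁) (M₂ := M₂) (fun _ => []) (fun _ => []) [] [] = fun _ => [] := by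
  funext j
  rcases j with j | j | _ | _ <;> rfl

/-- Each transfer through an auxiliary stack reverses twice and so preserves order. The copy of `x`
waits on the second machine's input stack during the first run, so the translated `y` lands on top
of it. -/
theorem steps_memo {n₁ n₂ : ℕ} {x : List (M₁.Γ M₁.k₀)} {y : List (M₁.Γ M₁.k₁)}
    {z : List (M₂.Γ M₂.k₁)}
    (h₁ : Steps (TM2.step M₁.m) n₁ ⟨some M₁.main, M₁.initialState, update (fun _ => []) M₁.k₀ x⟩
      ⟨none, M₁.initialState, update (fun _ => []) M₁.k₁ y⟩)
    (h₂ : Steps (TM2.step M₂.m) n₂ ⟨some M₂.main, M₂.initialState,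
        update (fun _ => []) M₂.k₀ (y.filterMap φ ++ x.filterMap ψ)⟩
      ⟨none, M₂.initialState, update (fun _ => []) M₂.k₁ z⟩) :
    Steps (TM2.step (memoProgram φ ψ))
      ((x.length + 1) + ((x.length + 1) + (n₁ + ((y.length + 1) + ((y.length + 1) + n₂)))))
      ⟨some (.inr (.inr .unload)), (M₁.initialState, M₂.initialState, none, none),
        update (fun _ => []) (.inl M₁.k₀) x⟩
      ⟨none, (M₁.initialState, M₂.initialState, none, none),
        update (fun _ => []) (.inr (.inl M₂.k₁)) z⟩ := by
  rw [← memoStk_nil, update_memoStk_fst, update_memoStk_snd]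
  refine (steps_unload φ ψ x [] _ [] _ _ _).trans ?_
  have h := steps_reload φ ψ x.reverse [] [] (fun _ => []) [] M₁.initialState M₂.initialState
    (fun _ => [])
  simp only [List.length_reverse, List.reverse_reverse, List.append_nil] at h ⊢
  rw [show update (fun _ => []) M₂.k₀ [] = fun k => ([] : List (M₂.Γ k)) by simp] at h
  refine h.trans ((steps_fst φ ψ h₁ _ _ _ _).trans ((steps_collect φ ψ y [] _ _ _ _ _).trans ?_))
  have h := steps_feed φ ψ y.reverse (x.filterMap ψ) (fun _ => []) [] M₁.initialState
    M₂.initialState (fun _ => [])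
  simp only [List.length_reverse, List.reverse_reverse, List.append_nil] at h ⊢
  rw [show update (fun _ => []) M₁.k₁ [] = fun k => ([] : List (M₁.Γ k)) by simp]
  exact h.trans (steps_snd φ ψ h₂ _ _ _ _)

end Memo

/-- If `F` and `G` are computable in polynomial time, then so is the composition that presents to
`G` the value of `F` together with the input of `F`, each after a letterwise translation. -/
theorem PolyTime.memo {α β γ δ αΓ βΓ γΓ δΓ : Type} [Finite βΓ] {ea : α → List αΓ}
    {eb : β → List βΓ} {ec : γ → List γΓ} {ed : δ → List δΓ} {F : α → β} {G : γ → δ} {h : α → γ}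
    (hF : PolyTime ea eb F) (hG : PolyTime ec ed G) (φ : βΓ → Option γΓ) (ψ : αΓ → Option γΓ)
    (e : ∀ a, ec (h a) = (eb (F a)).filterMap φ ++ (ea a).filterMap ψ) :
    PolyTime ea ed fun a => G (h a) := by
  obtain ⟨M₁, i₁, o₁, p₁, h₁⟩ := hF.elim
  obtain ⟨M₂, i₂, o₂, p₂, h₂⟩ := hG.elim
  -- The internal state buffers letters of this alphabet, so it must be finite; a `FinTM2`
  -- guarantees that only for its input stack.
  let _ : Fintype (M₁.Γ M₁.k₁) := @Fintype.ofFinite _ (Finite.of_equiv _ o₁.symm)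
  let _ := M₁.ΛFin
  obtain ⟨N, hN⟩ : ∃ N, ∀ l, pushes (M₁.m l) ≤ N :=
    ⟨Finset.univ.sup fun l => pushes (M₁.m l), fun l =>
      Finset.le_sup (f := fun l => pushes (M₁.m l)) (Finset.mem_univ l)⟩
  -- Bounds the length of the first output: initial height plus at most `N` letters per step.
  let r : Polynomial ℕ := .X + p₁ * .C N
  refine PolyTime.intro (memoMachine (fun b => (φ (o₁ b)).map i₂.symm)
    (fun a => (ψ (i₁ a)).map i₂.symm)) i₁ o₂
    (.X + 1 + (.X + 1 + (p₁ + (r + 1 + (r + 1 + p₂.comp (r + .X)))))) fun a => ?_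
  obtain ⟨n₁, hn₁, s₁⟩ := h₁ a
  obtain ⟨n₂, hn₂, s₂⟩ := h₂ (h a)
  have hr : (eb (F a)).length ≤ r.eval (ea a).length := by
    have := s₁.length_le hN M₁.k₁
    simp only [update_self, List.length_map] at this
    refine this.trans ?_
    simp only [r, Polynomial.eval_add, Polynomial.eval_mul, Polynomial.eval_X, Polynomial.eval_C]
    refine Nat.add_le_add ?_ (Nat.mul_le_mul_right _ hn₁)
    -- Input and output stack may coincide; the output stack initially holds the input or nothing.
    by_cases hk : M₁.k₁ = M₁.k₀
    · rw [hk]; simp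
    · simp [hk]
  have s := steps_memo (fun b => (φ (o₁ b)).map i₂.symm) (fun a => (ψ (i₁ a)).map i₂.symm) s₁
    (n₂ := n₂) (z := (ed (G (h a))).map o₂.symm) (by
      convert s₂ using 3
      rw [e]
      simp [List.filterMap_map, List.map_filterMap])
  simp only [List.length_map] at s
  refine ⟨_, ?_, s⟩
  have hp : p₂.eval (ec (h a)).length ≤ p₂.eval (r.eval (ea a).length + (ea a).length) := by
    refine eval_mono _ ?_
    rw [e, List.length_append]
    exact Nat.add_le_add ((List.length_filterMap_le _ _).trans hr) (List.length_filterMap_le _ _)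
  simp only [Polynomial.eval_add, Polynomial.eval_X, Polynomial.eval_one, Polynomial.eval_comp]
  omega

/-! ### Finite transducers -/

section Transduce

variable {Q A B : Type}

/-- The output of a finite transducer with transition function `δ`, output function `o` and a last
output `fin` at the end of the input. -/
def transduce (δ : Q → A → Q) (o : Q → A → List B) (fin : Q → List B) : Q → List A → List B
  | q, [] => fin q
  | q, a :: l => o q a ++ transduce δ o fin (δ q a) l

/-- The alphabets of the input stack and of the output stack. -/
abbrev TransΓ (A B : Type) : Bool → Type
  | false => A
  | true => B

/-- The two stacks together. -/
def transStk (l : List A) (r : List B) : ∀ k, List (TransΓ A B k)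
  | false => l
  | true => r

theorem update_transStk_false (l x : List A) (r : List B) :
    update (transStk l r) false x = transStk x r := by
  funext j
  cases j <;> simp [transStk]

theorem update_transStk_true (l : List A) (r x : List B) :
    update (transStk l r) true x = transStk l x := by
  funext j
  cases j <;> simp [transStk]

/-- The program of a transducer, with outputs of length at most `N`. -/
noncomputable def transProgram (δ : Q → A → Q) (o : Q → A → List B) (fin : Q → List B) (N : ℕ)
    (q₀ : Q) : Unit → TM2.Stmt (TransΓ A B) Unit (Q × Option A) := fun _ =>
  .pop false (fun s x => (s.1, x)) <|
  .branch (fun s => s.2.isSome)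
    (pushList true N (fun s => s.2.elim [] (o s.1)) <|
      .load (fun s => (s.2.elim s.1 (δ s.1), none)) <| .goto fun _ => ())
    (pushList true N (fun s => fin s.1) <| .load (fun _ => (q₀, none)) .halt)

theorem steps_trans {δ : Q → A → Q} {o : Q → A → List B} {fin : Q → List B} {N : ℕ}
    (q₀ : Q) (ho : ∀ q a, (o q a).length ≤ N) (hfin : ∀ q, (fin q).length ≤ N) (q : Q)
    (l : List A) (r : List B) :
    Steps (TM2.step (transProgram δ o fin N q₀)) (l.length + 1)
      ⟨some (), (q, none), transStk l r⟩
      ⟨none, (q₀, none), transStk [] ((transduce δ o fin q l).reverse ++ r)⟩ := by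
  induction l generalizing q r with
  | nil =>
    refine .head ?_ (.refl _)
    simp [TM2.step, transProgram, transStk, stepAux_pushList, hfin, update_transStk_false,
      update_transStk_true, transduce]
  | cons a l ih =>
    rw [transduce, List.reverse_append, List.append_assoc]
    refine .head ?_ (ih _ _)
    simp only [TM2.step, transProgram, transStk, TM2.stepAux, List.head?_cons, List.tail_cons,
      Option.isSome_some, cond_true, update_transStk_false]
    rw [stepAux_pushList _ _ _ _ _ _ (ho q a)]
    simp [transStk, update_transStk_true]

/-- Supplies the uniform bound that `pushList` needs, a statement being finite. -/
theorem exists_length_le [Finite Q] (f : Q → List B) : ∃ N, ∀ q, (f q).length ≤ N := by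
  have := Fintype.ofFinite Q
  exact ⟨Finset.univ.sup fun q => (f q).length, fun q =>
    Finset.le_sup (f := fun q => (f q).length) (Finset.mem_univ q)⟩

theorem polyTime_reverse_transduce [Finite Q] [Finite A] (δ : Q → A → Q) (o : Q → A → List B)
    (fin : Q → List B) (q₀ : Q) :
    PolyTime id id fun l => (transduce δ o fin q₀ l).reverse := by
  have := Fintype.ofFinite Q
  have := Fintype.ofFinite A
  obtain ⟨N₁, h₁⟩ := exists_length_le (Function.uncurry o)
  obtain ⟨N₂, h₂⟩ := exists_length_le fin
  refine PolyTime.intro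
    { K := Bool
      k₀ := false
      k₁ := true
      Γ := TransΓ A B
      Λ := Unit
      main := ()
      σ := Q × Option A
      initialState := (q₀, none)
      Γk₀Fin := (inferInstance : Fintype A)
      m := transProgram δ o fin (max N₁ N₂) q₀ } (Equiv.refl _) (Equiv.refl _) (.X + 1)
    fun l => ⟨l.length + 1, by simp, ?_⟩
  have h := steps_trans (δ := δ) (o := o) (N := max N₁ N₂) q₀ (fun q a => (h₁ (q, a)).trans (le_max_left _ _))
    (fun q => (h₂ q).trans (le_max_right _ _)) q₀ l []
  have e : transStk (A := A) (B := B) [] [] = fun _ => [] := by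
    funext j; cases j <;> rfl
  simp only [List.append_nil] at h
  rw [← update_transStk_false [] l [], ← update_transStk_true [] [] (transduce δ o fin q₀ l).reverse,
    e] at h
  simpa using h

end Transduce

/-! ### Reading two lists in parallel -/

section Zip

variable {A B : Type}

/-- The list of pairs of entries at the same positions, with `none` beyond the end of a list. -/
def zipPad : List A → List B → List (Option A × Option B)
  | [], [] => []
  | a :: u, [] => (some a, none) :: zipPad u []
  | [], b :: v => (none, some b) :: zipPad [] v
  | a :: u, b :: v => (some a, some b) :: zipPad u v

theorem length_zipPad_le (u : List A) (v : List B) :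
    (zipPad u v).length ≤ u.length + v.length := by
  induction u, v using zipPad.induct <;> simp [zipPad] at * <;> omega

/-- The stacks: input, the two components, output. -/
inductive ZipStack
  | inp | fst | snd | out
  deriving DecidableEq

instance : Fintype ZipStack :=
  ⟨{.inp, .fst, .snd, .out}, fun x => by cases x <;> simp⟩

/-- The alphabets. -/
abbrev ZipΓ (A B : Type) : ZipStack → Type
  | .inp => A ⊕ B
  | .fst => A
  | .snd => B
  | .out => Option A × Option B

/-- All stacks together. -/
def zipStk (l : List (A ⊕ B)) (u : List A) (v : List B) (r : List (Option A × Option B)) :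
    ∀ k, List (ZipΓ A B k)
  | .inp => l
  | .fst => u
  | .snd => v
  | .out => r

theorem update_zipStk_inp (l x : List (A ⊕ B)) (u : List A) (v : List B)
    (r : List (Option A × Option B)) :
    update (zipStk l u v r) .inp x = zipStk x u v r := by
  funext j
  cases j <;> simp [zipStk]

theorem update_zipStk_fst (l : List (A ⊕ B)) (u x : List A) (v : List B)
    (r : List (Option A × Option B)) :
    update (zipStk l u v r) .fst x = zipStk l x v r := by
  funext j
  cases j <;> simp [zipStk]

theorem update_zipStk_snd (l : List (A ⊕ B)) (u : List A) (v x : List B)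
    (r : List (Option A × Option B)) :
    update (zipStk l u v r) .snd x = zipStk l u x r := by
  funext j
  cases j <;> simp [zipStk]

theorem update_zipStk_out (l : List (A ⊕ B)) (u : List A) (v : List B)
    (r x : List (Option A × Option B)) :
    update (zipStk l u v r) .out x = zipStk l u v x := by
  funext j
  cases j <;> simp [zipStk]

/-- The program: distribute the input (label `false`), then read both components (label `true`). -/
noncomputable def zipProgram : Bool → TM2.Stmt (ZipΓ A B) Bool (Option A × Option B)
  | false =>
    .pop .inp (fun _ x => (x.bind Sum.getLeft?, x.bind Sum.getRight?)) <|
    .branch (fun s => s.1.isSome || s.2.isSome)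
      (pushList .fst 1 (fun s => s.1.toList) <| pushList .snd 1 (fun s => s.2.toList) <|
        .load (fun _ => (none, none)) <| .goto fun _ => false)
      (.goto fun _ => true)
  | true =>
    .pop .fst (fun _ x => (x, none)) <| .pop .snd (fun s x => (s.1, x)) <|
    .branch (fun s => s.1.isSome || s.2.isSome)
      (.push .out (fun s => s) <| .load (fun _ => (none, none)) <| .goto fun _ => true)
      .halt

theorem steps_zip_split (l : List (A ⊕ B)) (u : List A) (v : List B)
    (r : List (Option A × Option B)) :
    Steps (TM2.step zipProgram) (l.length + 1)
      ⟨some false, (none, none), zipStk l u v r⟩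
      ⟨some true, (none, none), zipStk [] ((l.filterMap Sum.getLeft?).reverse ++ u)
        ((l.filterMap Sum.getRight?).reverse ++ v) r⟩ := by
  induction l generalizing u v with
  | nil =>
    refine .head ?_ (.refl _)
    simp [TM2.step, zipProgram, zipStk, update_zipStk_inp]
  | cons c l ih =>
    cases c with
    | inl a =>
      refine .head ?_ (by simpa [List.filterMap_cons] using ih (a :: u) v)
      simp [TM2.step, zipProgram, zipStk, stepAux_pushList_toList, update_zipStk_inp,
        update_zipStk_fst, update_zipStk_snd]
    | inr b =>
      refine .head ?_ (by simpa [List.filterMap_cons] using ih u (b :: v))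
      simp [TM2.step, zipProgram, zipStk, stepAux_pushList_toList, update_zipStk_inp,
        update_zipStk_fst, update_zipStk_snd]

/-- Popping an empty stack returns `none`, which is exactly the padding; the run stops when both
pops fail. -/
theorem steps_zip (u : List A) (v : List B) (r : List (Option A × Option B)) :
    Steps (TM2.step zipProgram) ((zipPad u v).length + 1)
      ⟨some true, (none, none), zipStk [] u v r⟩
      ⟨none, (none, none), zipStk [] [] [] ((zipPad u v).reverse ++ r)⟩ := by
  induction u, v using zipPad.induct generalizing r with
  | case1 =>
    simp only [zipPad, List.length_nil, List.reverse_nil, List.nil_append]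
    refine .head ?_ (.refl _)
    simp [TM2.step, zipProgram, zipStk, update_zipStk_fst, update_zipStk_snd]
  | case2 a u ih =>
    rw [zipPad, List.reverse_cons, List.append_assoc]
    refine .head ?_ (ih _)
    simp [TM2.step, zipProgram, zipStk, update_zipStk_fst, update_zipStk_snd, update_zipStk_out]
  | case3 b v ih =>
    rw [zipPad, List.reverse_cons, List.append_assoc]
    refine .head ?_ (ih _)
    simp [TM2.step, zipProgram, zipStk, update_zipStk_fst, update_zipStk_snd, update_zipStk_out]
  | case4 a u b v ih =>
    rw [zipPad, List.reverse_cons, List.append_assoc]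
    refine .head ?_ (ih _)
    simp [TM2.step, zipProgram, zipStk, update_zipStk_fst, update_zipStk_snd, update_zipStk_out]

/-- Distributing the input reverses both components and pushing the result reverses once more;
`PolyTime.zipPad` cancels these reversals. -/
theorem polyTime_zipPad [Finite A] [Finite B] :
    PolyTime id id fun l : List (A ⊕ B) =>
      (zipPad (l.filterMap Sum.getLeft?).reverse (l.filterMap Sum.getRight?).reverse).reverse := by
  have := Fintype.ofFinite A
  have := Fintype.ofFinite B
  refine PolyTime.intro
    { K := ZipStack
      k₀ := .inp
      k₁ := .out
      Γ := ZipΓ A B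
      Λ := Bool
      main := false
      σ := Option A × Option B
      initialState := (none, none)
      Γk₀Fin := (inferInstance : Fintype (A ⊕ B))
      m := zipProgram } (Equiv.refl _) (Equiv.refl _) (3 * .X + 2) fun l => ?_
  have h := (steps_zip_split l [] [] []).trans (steps_zip _ _ _)
  have e : zipStk (A := A) (B := B) [] [] [] [] = fun _ => [] := by
    funext j; cases j <;> rfl
  simp only [List.append_nil] at h
  rw [← update_zipStk_inp [] l, ← update_zipStk_out _ _ _ [] (zipPad _ _).reverse, e] at h
  refine ⟨_, ?_, by simpa using h⟩
  have h1 := length_zipPad_le (l.filterMap Sum.getLeft?).reverse (l.filterMap Sum.getRight?).reverse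
  have h2 := List.length_filterMap_le Sum.getLeft? l
  have h3 := List.length_filterMap_le Sum.getRight? l
  simp only [List.length_reverse] at h1
  simp only [id, Polynomial.eval_add, Polynomial.eval_mul, Polynomial.eval_X,
    Polynomial.eval_ofNat]
  omega

end Zip

/-! ### Multiplication of unary numbers -/

section Mul

/-- The stacks: input, the two factors, an auxiliary stack, output. -/
inductive MulStack
  | inp | fst | snd | aux | out
  deriving DecidableEq

instance : Fintype MulStack :=
  ⟨{.inp, .fst, .snd, .aux, .out}, fun x => by cases x <;> simp⟩

/-- The labels. -/
inductive MulLabel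
  | split | outer | there | back | drain
  deriving DecidableEq

instance : Fintype MulLabel :=
  ⟨{.split, .outer, .there, .back, .drain}, fun x => by cases x <;> simp⟩

/-- All stacks together, those other than the input given by their heights. -/
def mulStk (l : List Bool) (m n k r : ℕ) : MulStack → List Bool
  | .inp => l
  | .fst => .replicate m true
  | .snd => .replicate n true
  | .aux => .replicate k true
  | .out => .replicate r true

theorem update_mulStk_inp (l x : List Bool) (m n k r : ℕ) :
    update (mulStk l m n k r) .inp x = mulStk x m n k r := by
  funext j
  cases j <;> simp [mulStk]

theorem update_mulStk_fst (l : List Bool) (m n k r x : ℕ) :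
    update (mulStk l m n k r) .fst (.replicate x true) = mulStk l x n k r := by
  funext j
  cases j <;> simp [mulStk]

theorem update_mulStk_snd (l : List Bool) (m n k r x : ℕ) :
    update (mulStk l m n k r) .snd (.replicate x true) = mulStk l m x k r := by
  funext j
  cases j <;> simp [mulStk]

theorem update_mulStk_aux (l : List Bool) (m n k r x : ℕ) :
    update (mulStk l m n k r) .aux (.replicate x true) = mulStk l m n x r := by
  funext j
  cases j <;> simp [mulStk]

theorem update_mulStk_out (l : List Bool) (m n k r x : ℕ) :
    update (mulStk l m n k r) .out (.replicate x true) = mulStk l m n k x := by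
  funext j
  cases j <;> simp [mulStk]

/-- The program: for every letter of the first factor, move the second factor to the auxiliary
stack, adding it to the output, and back. -/
def mulProgram : MulLabel → TM2.Stmt (fun _ : MulStack => Bool) MulLabel (Option Bool)
  | .split =>
    .pop .inp (fun _ x => x) <|
    .branch (fun s => s.isSome)
      (.branch (fun s => s == some true)
        (.push .fst (fun _ => true) <| .load (fun _ => none) <| .goto fun _ => .split)
        (.push .snd (fun _ => true) <| .load (fun _ => none) <| .goto fun _ => .split))
      (.goto fun _ => .outer)
  | .outer =>
    .pop .fst (fun _ x => x) <|
    .branch (fun s => s.isSome) (.load (fun _ => none) <| .goto fun _ => .there)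
      (.goto fun _ => .drain)
  | .there =>
    .pop .snd (fun _ x => x) <|
    .branch (fun s => s.isSome)
      (.push .aux (fun _ => true) <| .push .out (fun _ => true) <|
        .load (fun _ => none) <| .goto fun _ => .there)
      (.goto fun _ => .back)
  | .back =>
    .pop .aux (fun _ x => x) <|
    .branch (fun s => s.isSome)
      (.push .snd (fun _ => true) <| .load (fun _ => none) <| .goto fun _ => .back)
      (.goto fun _ => .outer)
  | .drain =>
    .pop .snd (fun _ x => x) <|
    .branch (fun s => s.isSome) (.load (fun _ => none) <| .goto fun _ => .drain) .halt

theorem steps_mul_split (l : List Bool) (m n k r : ℕ) :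
    Steps (TM2.step mulProgram) (l.length + 1)
      ⟨some .split, none, mulStk l m n k r⟩
      ⟨some .outer, none, mulStk [] (l.count true + m) (l.count false + n) k r⟩ := by
  induction l generalizing m n with
  | nil =>
    refine .head ?_ (.refl _)
    simp [TM2.step, mulProgram, mulStk, update_mulStk_inp]
  | cons c l ih =>
    cases c with
    | false =>
      refine .head ?_ (by simpa [add_right_comm, add_assoc] using ih m (n + 1))
      simp [TM2.step, mulProgram, mulStk, update_mulStk_inp, ← List.replicate_succ,
        update_mulStk_snd]
    | true =>
      refine .head ?_ (by simpa [add_right_comm, add_assoc] using ih (m + 1) n)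
      simp [TM2.step, mulProgram, mulStk, update_mulStk_inp, ← List.replicate_succ,
        update_mulStk_fst]

theorem steps_mul_there (m n k r : ℕ) :
    Steps (TM2.step mulProgram) (n + 1)
      ⟨some .there, none, mulStk [] m n k r⟩ ⟨some .back, none, mulStk [] m 0 (n + k) (n + r)⟩ := by
  induction n generalizing k r with
  | zero =>
    refine .head ?_ (.refl _)
    simp [TM2.step, mulProgram, mulStk]
  | succ n ih =>
    rw [Nat.add_right_comm n 1 k, Nat.add_right_comm n 1 r, Nat.add_assoc n k, Nat.add_assoc n r]
    refine .head ?_ (ih _ _)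
    simp [TM2.step, mulProgram, mulStk, List.head?_replicate, ← List.replicate_succ,
      update_mulStk_snd, update_mulStk_aux, update_mulStk_out]

theorem steps_mul_back (m n k r : ℕ) :
    Steps (TM2.step mulProgram) (k + 1)
      ⟨some .back, none, mulStk [] m n k r⟩ ⟨some .outer, none, mulStk [] m (k + n) 0 r⟩ := by
  induction k generalizing n with
  | zero =>
    refine .head ?_ (.refl _)
    simp [TM2.step, mulProgram, mulStk]
  | succ k ih =>
    rw [Nat.add_right_comm k 1 n, Nat.add_assoc k n]
    refine .head ?_ (ih _)
    simp [TM2.step, mulProgram, mulStk, List.head?_replicate, ← List.replicate_succ,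
      update_mulStk_snd, update_mulStk_aux]

theorem steps_mul_drain (n r : ℕ) :
    Steps (TM2.step mulProgram) (n + 1)
      ⟨some .drain, none, mulStk [] 0 n 0 r⟩ ⟨none, none, mulStk [] 0 0 0 r⟩ := by
  induction n with
  | zero =>
    refine .head ?_ (.refl _)
    simp [TM2.step, mulProgram, mulStk]
  | succ n ih =>
    refine .head ?_ ih
    simp [TM2.step, mulProgram, mulStk, List.head?_replicate, update_mulStk_snd]

/-- Each letter of the first factor costs one pop and two passes of `n + 1` steps, in all `2 * n +
3`; the last failing pop and the draining cost `n + 2`. -/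
theorem steps_mul_outer (m n r : ℕ) :
    Steps (TM2.step mulProgram) (m * (2 * n + 3) + (n + 2))
      ⟨some .outer, none, mulStk [] m n 0 r⟩ ⟨none, none, mulStk [] 0 0 0 (m * n + r)⟩ := by
  induction m generalizing r with
  | zero =>
    rw [Nat.zero_mul, Nat.zero_mul, Nat.zero_add, Nat.zero_add]
    refine .head ?_ (steps_mul_drain n r)
    simp [TM2.step, mulProgram, mulStk]
  | succ m ih =>
    have h := ((steps_mul_there m n 0 r).trans (steps_mul_back m 0 (n + 0) (n + r))).trans
      (ih (n + r))
    have e₁ : (m + 1) * (2 * n + 3) + (n + 2) =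
        n + 1 + (n + 0 + 1) + (m * (2 * n + 3) + (n + 2)) + 1 := by ring
    have e₂ : (m + 1) * n + r = m * n + (n + r) := by ring
    rw [e₁, e₂]
    refine .head ?_ h
    simp [TM2.step, mulProgram, mulStk, List.head?_replicate, update_mulStk_fst]

theorem polyTime_mul :
    PolyTime id id fun l : List Bool => List.replicate (l.count true * l.count false) true := by
  refine PolyTime.intro
    { K := MulStack
      k₀ := .inp
      k₁ := .out
      Γ := fun _ => Bool
      Λ := MulLabel
      main := .split
      σ := Option Bool
      initialState := none
      m := mulProgram } (Equiv.refl _) (Equiv.refl _)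
      (.X + 1 + (.X * (2 * .X + 3) + (.X + 2))) fun l => ?_
  have h := (steps_mul_split l 0 0 0 0).trans (steps_mul_outer _ _ _)
  have e : mulStk [] 0 0 0 0 = fun _ => [] := by
    funext j; cases j <;> rfl
  simp only [Nat.add_zero] at h
  rw [← update_mulStk_inp [] l, ← update_mulStk_out _ _ _ _ 0 (_ * _), e] at h
  refine ⟨_, ?_, by simpa using h⟩
  have h1 := List.count_le_length (a := true) (l := l)
  have h2 := List.count_le_length (a := false) (l := l)
  simp only [id, Polynomial.eval_add, Polynomial.eval_mul, Polynomial.eval_X,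
    Polynomial.eval_ofNat, Polynomial.eval_one]
  gcongr

end Mul

/-! ### Closure properties of the polynomial-time computable functions -/

/-- The machine sees only the letters, so types and encodings may change as long as the tape
contents agree. -/
theorem PolyTime.reencode {α β γ δ αΓ βΓ : Type} {ea : α → List αΓ} {eb : β → List βΓ}
    {ec : γ → List αΓ} {ed : δ → List βΓ} {G : γ → δ} (hG : PolyTime ec ed G) {f : α → β}
    (h : α → γ) (e₁ : ∀ a, ea a = ec (h a)) (e₂ : ∀ a, eb (f a) = ed (G (h a))) :
    PolyTime ea eb f := by
  obtain ⟨M, i, o, p, hM⟩ := hG.elim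
  exact PolyTime.intro M i o p fun a => by simpa only [e₁, e₂] using hM (h a)

theorem PolyTime.self {α αΓ : Type} [Finite αΓ] (ea : α → List αΓ) : PolyTime ea id ea := by
  have := Fintype.ofFinite αΓ
  exact PolyTime.reencode (ea := ea) (ec := ea) (ed := ea) (G := id) ⟨idComputableInPolyTime ea⟩ id
    (fun _ => rfl) fun _ => rfl

theorem PolyTime.comp_of_eq {α γ δ αΓ γΓ δΓ : Type} [Finite γΓ] {ea : α → List αΓ}
    {ec : γ → List γΓ} {ed : δ → List δΓ} {F : α → List γΓ} {G : γ → δ}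
    (hF : PolyTime ea id F) (hG : PolyTime ec ed G) (h : α → γ) (e : ∀ a, ec (h a) = F a) :
    PolyTime ea ed fun a => G (h a) :=
  hF.memo hG some (fun _ => none) fun a => by simp [e]

theorem PolyTime.comp {α β γ αΓ βΓ γΓ : Type} [Finite βΓ] {ea : α → List αΓ} {eb : β → List βΓ}
    {ec : γ → List γΓ} {F : α → β} {G : β → γ} (hF : PolyTime ea eb F) (hG : PolyTime eb ec G) :
    PolyTime ea ec fun a => G (F a) :=
  hF.memo hG some (fun _ => none) fun a => by simp

section Closure

variable {A B : Type}

theorem transduce_reverse_eq (l : List A) :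
    transduce (fun (_ : Unit) (_ : A) => ()) (fun _ a => [a]) (fun _ => []) () l = l := by
  induction l with
  | nil => rfl
  | cons a l ih => rw [transduce, ih]; rfl

/-- The identity transducer, run on a machine that pushes its output, reverses its input. -/
theorem PolyTime.reverse {α αΓ : Type} {ea : α → List αΓ} [Finite A] {F : α → List A} (hF : PolyTime ea id F) :
    PolyTime ea id fun a => (F a).reverse := by
  have h := polyTime_reverse_transduce (fun (_ : Unit) (_ : A) => ()) (fun _ a => [a])
    (fun _ => []) ()
  simp only [transduce_reverse_eq] at h
  exact hF.comp h

theorem transduce_filterMap_eq (f : A → Option B) (l : List A) :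
    OneWay.transduce (fun (_ : Unit) (_ : A) => ()) (fun _ a => (f a).toList) (fun _ => []) () l =
      l.filterMap f := by
  induction l with
  | nil => rfl
  | cons a l ih => rw [OneWay.transduce, ih]; cases h : f a <;> simp [h]

/-- The leading control bit becomes the state and decides which of the two tags is kept; the initial
state `q` plays no role. -/
theorem transduce_select (c q : Bool) (F G : List B) :
    OneWay.transduce (fun q => Sum.elim id fun _ => q)
      (fun q => Sum.elim (fun _ => []) (Sum.elim (bif q then [·] else []) (bif q then [] else [·])))
      (fun _ => []) q (.inl c :: (F.map Sum.inl ++ G.map Sum.inr).map Sum.inr) =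
      if c = true then F else G := by
  have hG : ∀ G : List B, OneWay.transduce (fun q => Sum.elim id fun _ => q)
      (fun q => Sum.elim (fun _ => []) (Sum.elim (bif q then [·] else []) (bif q then [] else [·])))
      (fun _ => []) c ((G.map (Sum.inr (α := B))).map Sum.inr) = if c = true then [] else G := by
    intro G
    induction G with
    | nil => simp [OneWay.transduce]
    | cons b G ih => simp only [List.map_cons, OneWay.transduce, Sum.elim_inr, ih]; cases c <;> simp
  rw [OneWay.transduce]
  simp only [Sum.elim_inl, id, List.nil_append]
  induction F with
  | nil => simpa using hG G
  | cons b F ih =>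
    simp only [List.map_cons, List.cons_append, OneWay.transduce, Sum.elim_inr, Sum.elim_inl, ih]
    cases c <;> simp

/-- If the lengths differ, some pair has `none` on one side only, so the comparison fails there. -/
theorem zipPad_all [DecidableEq A] (u v : List A) :
    (OneWay.zipPad u v).all (fun p => decide (p.1 = p.2)) = decide (u = v) := by
  induction u, v using zipPad.induct <;> simp_all [OneWay.zipPad]

theorem zipPad_filterMap (u : List A) (v : List B) :
    (OneWay.zipPad u v).filterMap (fun p => if p.1.isSome then none else p.2) =
      v.drop u.length := by
  induction u, v using zipPad.induct with
  | case1 => simp [OneWay.zipPad]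
  | case2 a u ih => simpa [OneWay.zipPad] using ih
  | case3 b v ih => simpa [OneWay.zipPad] using ih
  | case4 a u b v ih => simpa [OneWay.zipPad] using ih

variable {α αΓ Q : Type} {ea : α → List αΓ} [Finite A] [Finite B] [Finite Q]

theorem PolyTime.transduce {F : α → List A} (hF : PolyTime ea id F) (δ : Q → A → Q)
    (o : Q → A → List B) (fin : Q → List B) (q : Q) :
    PolyTime ea id fun a => transduce δ o fin q (F a) := by
  simpa using (hF.comp (polyTime_reverse_transduce δ o fin q)).reverse

theorem PolyTime.filterMap {F : α → List A} (hF : PolyTime ea id F) (f : A → Option B) :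
    PolyTime ea id fun a => (F a).filterMap f := by
  simpa only [transduce_filterMap_eq] using hF.transduce (fun (_ : Unit) (_ : A) => ())
    (fun _ a => (f a).toList) (fun _ => []) ()

theorem PolyTime.map {F : α → List A} (hF : PolyTime ea id F) (f : A → B) :
    PolyTime ea id fun a => (F a).map f := by
  simpa using hF.filterMap (fun a => some (f a))

variable [Finite αΓ]

theorem PolyTime.const (ea : α → List αΓ) (c : List B) : PolyTime ea id fun _ => c := by
  have h : ∀ l : List αΓ, OneWay.transduce (fun (_ : Unit) (_ : αΓ) => ()) (fun _ _ => [])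
      (fun _ => c) () l = c := fun l => by
    induction l with
    | nil => rfl
    | cons a l ih => rw [OneWay.transduce, ih]; rfl
  simpa only [h] using (PolyTime.self ea).transduce (fun (_ : Unit) (_ : αΓ) => ())
    (fun _ _ => []) (fun _ => c) ()

/-- The tagged word `H a`, holding both `G a` and the input, serves as a new encoding of `a`. From
it `F` is computed on the input part, while `PolyTime.memo` retains the part with `G a`. -/
theorem PolyTime.append {F G : α → List B} (hF : PolyTime ea id F) (hG : PolyTime ea id G) :
    PolyTime ea id fun a => F a ++ G a := by
  let H : α → List (B ⊕ αΓ) := fun a => (G a).map .inl ++ (ea a).map .inr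
  have hl : ∀ a, (H a).filterMap Sum.getLeft? = G a := fun a => by
    simp [H, List.filterMap_map, Function.comp_def]
  have hr : ∀ a, (H a).filterMap Sum.getRight? = ea a := fun a => by
    simp [H, List.filterMap_map, Function.comp_def]
  have hH : PolyTime ea id H := hG.memo (PolyTime.self (id : List (B ⊕ αΓ) → _))
    (fun b => some (.inl b)) (fun b => some (.inr b)) fun a => by simp
  have hF' : PolyTime H id F :=
    ((PolyTime.self H).filterMap Sum.getRight?).comp_of_eq hF id fun a => (hr a).symm
  have hFG : PolyTime H id fun a => F a ++ G a :=
    hF'.memo (PolyTime.self (id : List B → _)) some Sum.getLeft? fun a => by simp [hl]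
  exact hH.comp_of_eq hFG id fun _ => rfl

theorem PolyTime.cons {F : α → List B} (hF : PolyTime ea id F) (b : B) :
    PolyTime ea id fun a => b :: F a :=
  (PolyTime.const ea [b]).append hF

/-- The tagged concatenation, from which both lists can be recovered. -/
theorem PolyTime.tagged {F : α → List A} {G : α → List B} (hF : PolyTime ea id F)
    (hG : PolyTime ea id G) :
    PolyTime ea id fun a => (F a).map (Sum.inl (β := B)) ++ (G a).map Sum.inr :=
  (hF.map _).append (hG.map _)

theorem PolyTime.ite {c : α → Bool} {F G : α → List B} (hc : PolyTime ea encodeBit c)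
    (hF : PolyTime ea id F) (hG : PolyTime ea id G) :
    PolyTime ea id fun a => if c a = true then F a else G a := by
  have hc' : PolyTime ea id fun a => [c a] := hc.reencode id (fun _ => rfl) fun _ => rfl
  simpa only [List.map_cons, List.map_nil, List.singleton_append, transduce_select] using
    (hc'.tagged (hF.tagged hG)).transduce (fun q => Sum.elim id fun _ => q)
    (fun q => Sum.elim (fun _ => []) (Sum.elim (bif q then [·] else []) (bif q then [] else [·])))
    (fun _ => []) true

theorem PolyTime.zipPad {F : α → List A} {G : α → List B} (hF : PolyTime ea id F)
    (hG : PolyTime ea id G) : PolyTime ea id fun a => zipPad (F a) (G a) := by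
  simpa [List.filterMap_map, Function.comp_def] using
    ((hF.reverse.tagged hG.reverse).comp polyTime_zipPad).reverse

theorem PolyTime.decide_eq [DecidableEq A] {F G : α → List A} (hF : PolyTime ea id F)
    (hG : PolyTime ea id G) : PolyTime ea encodeBit fun a => decide (F a = G a) := by
  have h : ∀ (l : List (Option A × Option A)) (q : Bool),
      OneWay.transduce (fun q p => q && decide (p.1 = p.2)) (fun _ _ => []) (fun q => [q]) q l =
        [q && l.all fun p => decide (p.1 = p.2)] := fun l => by
    induction l with
    | nil => simp [OneWay.transduce]
    | cons a l ih => intro q; rw [OneWay.transduce, ih]; simp [Bool.and_assoc]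
  have := (hF.zipPad hG).transduce (fun q p => q && decide (p.1 = p.2)) (fun _ _ => [])
    (fun q => [q]) true
  simp only [h, zipPad_all, Bool.true_and] at this
  exact this.reencode id (fun _ => rfl) fun _ => rfl

theorem PolyTime.drop {F : α → List A} {G : α → List B} (hF : PolyTime ea id F)
    (hG : PolyTime ea id G) : PolyTime ea id fun a => (G a).drop (F a).length := by
  simpa only [zipPad_filterMap] using
    (hF.zipPad hG).filterMap fun p => if p.1.isSome then none else p.2

theorem PolyTime.unary_mul {m n : α → ℕ} (hm : PolyTime ea id fun a => List.replicate (m a) true)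
    (hn : PolyTime ea id fun a => List.replicate (n a) true) :
    PolyTime ea id fun a => List.replicate (m a * n a) true := by
  have h := (hm.append (hn.map fun _ => false)).comp polyTime_mul
  simpa [List.count_replicate] using h

/-- Sums are concatenations, and a monomial is built by repeated multiplication with the input
length. -/
theorem PolyTime.unary_eval (ea : α → List αΓ) (p : Polynomial ℕ) :
    PolyTime ea id fun a => List.replicate (p.eval (ea a).length) true := by
  induction p using Polynomial.induction_on' with
  | add p q hp hq =>
    simpa only [Polynomial.eval_add, List.replicate_add] using hp.append hq
  | monomial n c =>
    induction n with
    | zero => simpa using PolyTime.const ea (List.replicate c true)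
    | succ n ih =>
      have h := ih.unary_mul (n := fun a => (ea a).length)
        (by simpa using (PolyTime.self ea).map fun _ => true)
      simpa only [Polynomial.eval_monomial, pow_succ, mul_assoc] using h

end Closure

/-! ### Projections of pairs -/

/-- The transducer that reads one component of an encoded pair: the component is `true` for the
first one; the state tells whether the separator has been passed. -/
theorem transduce_pair (c : Bool) (p : Word × Word) :
    transduce (fun (q : Bool) (x : Option Bool) => q && x.isSome)
      (fun q x => if q = c then x.toList else []) (fun _ => []) true (encodePair p) =
      if c then p.1 else p.2 := by
  obtain ⟨u, v⟩ := p
  have h : transduce (fun (q : Bool) (x : Option Bool) => q && x.isSome)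
      (fun q x => if q = c then x.toList else []) (fun _ => []) false (v.map some) =
      if c then [] else v := by
    induction v with
    | nil => simp [transduce]
    | cons b v ih => cases c <;> simp_all [transduce]
  induction u with
  | nil => cases c <;> simp_all [transduce, encodePair]
  | cons b u ih => cases c <;> simp_all [transduce, encodePair]

section Pair

variable {α αΓ : Type} {ea : α → List αΓ}

theorem PolyTime.fst {F : α → Word × Word} (hF : PolyTime ea encodePair F) :
    PolyTime ea id fun a => (F a).1 := by
  have h := (PolyTime.self encodePair).transduce (fun (q : Bool) (x : Option Bool) => q && x.isSome)
    (fun q x => if q = true then x.toList else []) (fun _ => []) true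
  simp only [transduce_pair true] at h
  exact hF.comp h

theorem PolyTime.snd {F : α → Word × Word} (hF : PolyTime ea encodePair F) :
    PolyTime ea id fun a => (F a).2 := by
  have h := (PolyTime.self encodePair).transduce (fun (q : Bool) (x : Option Bool) => q && x.isSome)
    (fun q x => if q = false then x.toList else []) (fun _ => []) true
  simp only [transduce_pair false] at h
  exact hF.comp h

theorem PolyTime.apply {F : α → Word} {G : Word → Word} (hG : PolyTime encodeWord encodeWord G)
    (hF : PolyTime ea id F) : PolyTime ea id fun a => G (F a) :=
  hF.comp (hG.reencode (ea := id) (eb := id) id (fun _ => rfl) fun _ => rfl)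

end Pair

theorem polyTime_fst : PolyTime encodePair id (Prod.fst : Word × Word → Word) :=
  PolyTime.fst (F := fun p => p) ((PolyTime.self encodePair).reencode id (fun _ => rfl) fun _ => rfl)

theorem polyTime_snd : PolyTime encodePair id (Prod.snd : Word × Word → Word) :=
  PolyTime.snd (F := fun p => p) ((PolyTime.self encodePair).reencode id (fun _ => rfl) fun _ => rfl)

theorem polyTime_word : PolyTime encodeWord id (fun a : Word => a) :=
  PolyTime.self encodeWord

/-! ### P is contained in NP -/

theorem classP_subset_classNP : classP ⊆ classNP := by
  rintro L ⟨d, hd, hL⟩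
  refine ⟨fun p => d p.1, 0, ?_, fun x => ?_⟩
  · exact polyTime_fst.comp (hd.reencode (ea := id) id (fun _ => rfl) fun _ => rfl)
  · rw [hL]
    exact ⟨fun h => ⟨[], by simp, h⟩, fun ⟨_, _, h⟩ => h⟩

/-! ### A one-way function from a hard language -/

/-- The letters of a word, each preceded by the letter 1. -/
def double (x : Word) : Word := x.flatMap fun b => [true, b]

/-- A word read as a doubled word, the letter 0, padding by letters 0, the letter 1 and a second
word. -/
def parse : Word → Word × Word
  | true :: b :: t => (b :: (parse t).1, (parse t).2)
  | false :: t => ([], (t.dropWhile fun b => !b).tail)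
  | [true] => ([], [])
  | [] => ([], [])

/-- The word with the padding and the second component overwritten by letters 1. -/
def blank : Word → Word
  | true :: b :: t => true :: b :: blank t
  | false :: t => false :: t.map fun _ => true
  | [true] => [true]
  | [] => []

/-- The function that replaces a certificate accepted by `v` by padding. -/
def forget (v : Word × Word → Bool) (a : Word) : Word :=
  if v (parse a) = true then true :: blank a else false :: a

/-- The image of all certificates of length at most `n` for the word `x`. -/
def query (x : Word) (n : ℕ) : Word := double x ++ false :: List.replicate (n + 1) true

theorem length_blank (a : Word) : (blank a).length = a.length := by
  induction a using blank.induct <;> simp_all [blank]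

/-- `blank` keeps the doubled part and the separator, so `x` can be read off. After the separator
there are `n + 1` letters, of which the delimiter 1, if present, takes one. -/
theorem blank_eq_query {a x : Word} {n : ℕ} (h : blank a = query x n) :
    (parse a).1 = x ∧ (parse a).2.length ≤ n := by
  induction a using blank.induct generalizing x with
  | case1 b t ih =>
    cases x with
    | nil => simp [blank, query, double] at h
    | cons c x =>
      simp only [blank, query, double, List.flatMap_cons, List.cons_append, List.nil_append,
        List.cons.injEq, true_and] at h
      obtain ⟨rfl, h⟩ := h
      have := ih h
      exact ⟨by rw [parse, this.1], this.2⟩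
  | case2 t =>
    cases x with
    | nil =>
      have hl : t.length = n + 1 := by simpa [blank, query, double] using congrArg List.length h
      refine ⟨rfl, ?_⟩
      have := List.length_dropWhile_le (fun b => !b) t
      simp only [parse, List.length_tail]
      omega
    | cons c x => simp [blank, query, double] at h
  | case3 =>
    cases x <;> simp [blank, query, double] at h
  | case4 =>
    cases x <;> simp [blank, query, double] at h

theorem exists_parse_eq (x w : Word) {n : ℕ} (h : w.length ≤ n) :
    ∃ a, parse a = (x, w) ∧ blank a = query x n := by
  -- The padding brings the part after the separator to length `n + 1`, independently of `w`.
  refine ⟨double x ++ false :: (List.replicate (n - w.length) false ++ true :: w), ?_⟩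
  induction x with
  | nil =>
    have : ∀ k, (List.replicate k false ++ true :: w).dropWhile (fun b => !b) = true :: w :=
      fun k => by simp
    refine ⟨by simp [double, parse, this], ?_⟩
    simp only [double, List.flatMap_nil, List.nil_append, blank, query, List.cons.injEq, true_and]
    rw [List.map_const', List.length_append, List.length_replicate, List.length_cons]
    congr 1
    omega
  | cons b x ih =>
    simp only [double, query, List.flatMap_cons, List.cons_append, List.nil_append, parse, blank]
      at ih ⊢
    exact ⟨by rw [ih.1], by rw [ih.2]⟩

/-- The states of the transducers for `parse` and `blank`: at an odd place of the doubled word, at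
an even place of it, in the padding, in the second word. -/
inductive ParseState
  | mark | letter | pad | copy
  deriving DecidableEq

instance : Fintype ParseState :=
  ⟨{.mark, .letter, .pad, .copy}, fun x => by cases x <;> simp⟩

/-- The transitions. -/
def ParseState.next : ParseState → Bool → ParseState
  | .mark, b => bif b then .letter else .pad
  | .letter, _ => .mark
  | .pad, b => bif b then .copy else .pad
  | .copy, _ => .copy

/-- The letters of the encoding of `parse a`. -/
def ParseState.out : ParseState → Bool → List (Option Bool)
  | .mark, b => bif b then [] else [none]
  | .letter, b => [some b]
  | .pad, _ => []
  | .copy, b => [some b]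

/-- The separator, if it is still missing at the end. -/
def ParseState.last : ParseState → List (Option Bool)
  | .mark => [none]
  | .letter => [none]
  | .pad => []
  | .copy => []

/-- The letters of `blank a`. -/
def ParseState.blankOut : ParseState → Bool → List Bool
  | .mark, b => [b]
  | .letter, b => [b]
  | .pad, _ => [true]
  | .copy, _ => [true]

theorem transduce_parse (a : Word) :
    transduce ParseState.next ParseState.out ParseState.last .mark a = encodePair (parse a) := by
  have hc : ∀ t, transduce ParseState.next ParseState.out ParseState.last .copy t = t.map some := by
    intro t
    induction t with
    | nil => rfl
    | cons b t ih => simp [transduce, ParseState.next, ParseState.out, ih]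
  have hp : ∀ t, transduce ParseState.next ParseState.out ParseState.last .pad t =
      (t.dropWhile fun b => !b).tail.map some := by
    intro t
    induction t with
    | nil => rfl
    | cons b t ih => cases b <;> simp [transduce, ParseState.next, ParseState.out, ih, hc]
  induction a using parse.induct with
  | case1 b t ih =>
    simp [transduce, ParseState.next, ParseState.out, ih, parse, encodePair]
  | case2 t => simp [transduce, ParseState.next, ParseState.out, hp, parse, encodePair]
  | case3 => rfl
  | case4 => rfl

theorem transduce_blank (a : Word) :
    transduce ParseState.next ParseState.blankOut (fun _ => []) .mark a = blank a := by
  have hc : ∀ t, transduce ParseState.next ParseState.blankOut (fun _ => []) .copy t =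
      t.map fun _ => true := by
    intro t
    induction t with
    | nil => rfl
    | cons b t ih => rw [transduce, ParseState.next, ih]; rfl
  have hp : ∀ t, transduce ParseState.next ParseState.blankOut (fun _ => []) .pad t =
      t.map fun _ => true := by
    intro t
    induction t with
    | nil => rfl
    | cons b t ih =>
      cases b
      · simpa [transduce, ParseState.next, ParseState.blankOut] using ih
      · simpa [transduce, ParseState.next, ParseState.blankOut] using hc t
  induction a using blank.induct with
  | case1 b t ih => simp [transduce, ParseState.next, ParseState.blankOut, ih, blank]
  | case2 t =>
    rw [transduce, ParseState.next, cond_false, hp]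
    rfl
  | case3 => rfl
  | case4 => rfl

theorem transduce_double (x : Word) :
    transduce (fun (_ : Unit) (_ : Bool) => ()) (fun _ b => [true, b]) (fun _ => []) () x =
      double x := by
  induction x with
  | nil => rfl
  | cons b x ih => rw [transduce, ih]; rfl

theorem polyTime_forget {v : Word × Word → Bool} (hv : PolyTime encodePair encodeBit v) :
    PolyTime encodeWord encodeWord (forget v) := by
  have hp := polyTime_word.transduce ParseState.next ParseState.out ParseState.last .mark
  have hb := polyTime_word.transduce ParseState.next ParseState.blankOut (fun _ => []) .mark
  simp only [transduce_parse] at hp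
  simp only [transduce_blank] at hb
  have hc : PolyTime encodeWord encodeBit fun a => v (parse a) :=
    hp.comp_of_eq hv parse fun _ => rfl
  exact (hc.ite (hb.cons true) (polyTime_word.cons false)).reencode id (fun _ => rfl) fun _ => rfl

theorem polyTime_query (p : Polynomial ℕ) :
    PolyTime encodeWord id fun x => query x (p.eval x.length) := by
  have h₁ := polyTime_word.transduce (fun (_ : Unit) (_ : Bool) => ()) (fun _ b => [true, b])
    (fun _ => []) ()
  simp only [transduce_double] at h₁
  have h₂ := PolyTime.unary_eval encodeWord (p + 1)
  simp only [Polynomial.eval_add, Polynomial.eval_one] at h₂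
  exact h₁.append (h₂.cons false)

theorem honest_forget (v : Word × Word → Bool) : Honest₁ (forget v) := by
  refine ⟨.X, ?_⟩
  rintro _ ⟨a, rfl⟩
  refine ⟨a, ?_, rfl⟩
  rw [Polynomial.eval_X, forget]
  split_ifs <;> simp [length_blank]

/-- A word with leading 1 arises only from an accepted `a`, and its image then determines the
instance and bounds the certificate. -/
theorem mem_iff_forget {L : Language Bool} {v : Word × Word → Bool} {p : Polynomial ℕ}
    (hL : ∀ x : Word, x ∈ L ↔ ∃ w : Word, w.length ≤ p.eval x.length ∧ v (x, w) = true)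
    (x : Word) : x ∈ L ↔ true :: query x (p.eval x.length) ∈ Set.range (forget v) := by
  rw [hL]
  constructor
  · rintro ⟨w, hw, h⟩
    obtain ⟨a, ha, hb⟩ := exists_parse_eq x w hw
    exact ⟨a, by rw [forget, ha, if_pos h, hb]⟩
  · rintro ⟨a, ha⟩
    rw [forget] at ha
    split_ifs at ha with h
    · obtain ⟨h₁, h₂⟩ := blank_eq_query (List.cons.inj ha).2
      exact ⟨(parse a).2, h₂, h₁ ▸ h⟩
    · cases ha

/-- If P differs from NP, then one-way functions of one argument exist. -/
theorem exists_isOneWay₁ (hPNP : classP ≠ classNP) : ∃ ρ, IsOneWay₁ ρ := by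
  obtain ⟨L, ⟨v, p, hv, hL⟩, hLP⟩ : ∃ L ∈ classNP, L ∉ classP := by
    by_contra! h
    exact hPNP (classP_subset_classNP.antisymm h)
  refine ⟨forget v, honest_forget v, polyTime_forget hv, ?_⟩
  rintro ⟨g, hg, h⟩
  have hq := (polyTime_query p).cons true
  -- Outside the range `g` returns an arbitrary word, but then the equality test fails, as no word
  -- is a preimage.
  refine hLP ⟨_, ((polyTime_forget hv).apply (hg.apply hq)).decide_eq hq, fun x => ?_⟩
  rw [mem_iff_forget hL, decide_eq_true_iff]
  exact ⟨fun hx => h _ hx, fun hx => ⟨_, hx⟩⟩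

/-! ### The function of two arguments -/

/-- The two-argument function that hides `ρ` on the diagonal. -/
def diagonal (ρ : Word → Word) (p : Word × Word) : Word :=
  if p.1 = p.2 then true :: ρ p.1 else false :: (p.1 ++ p.2)

variable {ρ : Word → Word}

theorem diagonal_eq_true {a b z : Word} (h : diagonal ρ (a, b) = true :: z) : a = b ∧ ρ a = z := by
  rw [diagonal] at h
  split_ifs at h with e
  · exact ⟨e, (List.cons.inj h).2⟩
  · cases h

theorem polyTime_diagonal (hρ : PolyTime encodeWord encodeWord ρ) :
    PolyTime encodePair encodeWord (diagonal ρ) := by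
  have h := (polyTime_fst.decide_eq polyTime_snd).ite ((hρ.apply polyTime_fst).cons true)
    ((polyTime_fst.append polyTime_snd).cons false)
  exact h.reencode id (fun _ => rfl) fun p => by simp [diagonal, encodeWord]

/-- Holds for every preimage, so s-honesty needs no shorter one: on the diagonal the arguments are
equal, elsewhere both are part of `z`. -/
theorem length_le_of_diagonal_eq {a b z : Word} (h : diagonal ρ (a, b) = z) :
    a.length ≤ z.length + b.length ∧ b.length ≤ z.length + a.length := by
  rw [diagonal] at h
  split_ifs at h with e
  · simp only at e
    subst e
    omega
  · subst h
    simp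
    omega

theorem sHonest_diagonal (ρ : Word → Word) : SHonest (diagonal ρ) := by
  refine ⟨.X, ?_, ?_⟩
  · rintro z a ⟨b, h⟩
    exact ⟨b, by simpa using (length_le_of_diagonal_eq h).2, h⟩
  · rintro z b ⟨a, h⟩
    exact ⟨a, by simpa using (length_le_of_diagonal_eq h).1, h⟩

theorem isOneWay₂_diagonal (hρ : IsOneWay₁ ρ) : IsOneWay₂ (diagonal ρ) := by
  obtain ⟨⟨q, hq⟩, hp, hn⟩ := hρ
  -- `2 * q` pays for a short preimage of `ρ` used as both arguments, `.X` for the arguments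
  -- contained in an off-diagonal value.
  refine ⟨⟨2 * q + .X, ?_⟩, polyTime_diagonal hp, ?_⟩
  · rintro _ ⟨⟨a, b⟩, rfl⟩
    by_cases e : a = b
    · obtain ⟨a', hl, ha⟩ := hq (ρ a) ⟨a, rfl⟩
      refine ⟨a', a', ?_, by simp [diagonal, e, ha]⟩
      have := eval_mono q (Nat.le_add_right (ρ a).length 1)
      simp only [diagonal, e, if_true, List.length_cons, Polynomial.eval_add, Polynomial.eval_mul,
        Polynomial.eval_X, Polynomial.eval_ofNat] at hl this ⊢
      omega
    · refine ⟨a, b, ?_, rfl⟩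
      simp only [diagonal, e, if_false, List.length_cons, List.length_append, Polynomial.eval_add,
        Polynomial.eval_X]
      omega
  · rintro ⟨g, hg, h⟩
    refine hn ⟨fun z => (g (true :: z)).1, ?_, ?_⟩
    · have h₁ := (polyTime_word.cons true).comp (hg.reencode (ea := id) id (fun _ => rfl) fun _ => rfl)
      exact h₁.fst.reencode id (fun _ => rfl) fun _ => rfl
    · rintro _ ⟨a, rfl⟩
      exact (diagonal_eq_true (h (true :: ρ a) ⟨(a, a), by simp [diagonal]⟩)).2

/-! ### Inversion with one argument prescribed -/

theorem polyTime_head :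
    PolyTime encodePair encodeBit fun p : Word × Word => decide (p.2.head? = some true) := by
  have h : ∀ (l : Word) (q : Option Bool),
      transduce (fun q b => q.or (some b)) (fun _ _ => []) (fun q => [decide (q = some true)]) q l =
        [decide (q.or l.head? = some true)] := fun l => by
    induction l with
    | nil => simp [transduce]
    | cons b l ih => intro q; rw [transduce, ih]; cases q <;> simp
  have := polyTime_snd.transduce (fun q b => q.or (some b)) (fun _ _ => [])
    (fun q => [decide (q = some true)]) none
  simp only [h, Option.none_or] at this
  exact this.reencode id (fun _ => rfl) fun _ => rfl

theorem invertibleFst_diagonal (ρ : Word → Word) : InvertibleFst (diagonal ρ) := by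
  -- Off the diagonal the tag and the known prefix are dropped together; the extra letter in `true
  -- :: p.1` accounts for the tag.
  refine ⟨fun p => if decide (p.2.head? = some true) = true then p.1 else
    p.2.drop (true :: p.1).length, ?_, ?_⟩
  · exact (polyTime_head.ite polyTime_fst ((polyTime_fst.cons true).drop polyTime_snd)).reencode id
      (fun _ => rfl) fun _ => rfl
  · rintro _ - a b rfl
    by_cases e : a = b
    · simp [diagonal, e]
    · simp [diagonal, e]

theorem invertibleSnd_diagonal (ρ : Word → Word) : InvertibleSnd (diagonal ρ) := by
  -- Here the known argument is a suffix, so after removing the tag it is dropped from the reversed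
  -- word.
  refine ⟨fun p => if decide (p.2.head? = some true) = true then p.1 else
    ((p.2.drop [true].length).reverse.drop p.1.length).reverse, ?_, ?_⟩
  · exact (polyTime_head.ite polyTime_fst (polyTime_fst.drop
      ((PolyTime.const encodePair [true]).drop polyTime_snd).reverse).reverse).reencode id
      (fun _ => rfl) fun _ => rfl
  · rintro _ - a b rfl
    by_cases e : a = b
    · simp [diagonal, e]
    · have h : ((a ++ b).reverse.drop b.length).reverse = a := by
        rw [List.reverse_append, ← List.length_reverse (as := b), List.drop_left,
          List.reverse_reverse]
      simp only [diagonal, e, if_false, List.head?_cons, Option.some.injEq, Bool.false_eq_true,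
        decide_false, List.length_singleton, List.drop_succ_cons, List.drop_zero, h]

end OneWay

theorem theorem3p4 (hPNP : OneWay.classP ≠ OneWay.classNP) :
    ∃ (σ : OneWay.Word × OneWay.Word → OneWay.Word) (ρ : OneWay.Word → OneWay.Word),
      OneWay.SHonest σ ∧
      OneWay.IsOneWay₂ σ ∧
      OneWay.InvertibleFst σ ∧
      OneWay.InvertibleSnd σ ∧
      OneWay.IsOneWay₁ ρ ∧
      ∀ a b : OneWay.Word, σ (a, b) = if a = b then true :: ρ a else false :: (a ++ b) := by
  obtain ⟨ρ, hρ⟩ := OneWay.exists_isOneWay₁ hPNP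
  exact ⟨OneWay.diagonal ρ, ρ, OneWay.sHonest_diagonal ρ, OneWay.isOneWay₂_diagonal hρ,
    OneWay.invertibleFst_diagonal ρ, OneWay.invertibleSnd_diagonal ρ, hρ, fun _ _ => rfl⟩
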